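/- **Setting.** Sensor nodes $\mathcal V=\{1,\dots,n\}$ at unknown positions in $\mathbb R^2$ are joined by a connected graph $\mathcal G=(\mathcal V,\mathcal E)$; $\mathcal N_i$ is the set of neighbors of $i$, and $\mathcal N_{i,\mathrm a}$ the set of anchors (with known positions $a_k$) that neighbor $i$. Measurements $r_{i,j}$ (for $(i,j)\in\mathcal E$) and $v_{i,k}$ (for $k\in\mathcal N_{i,\mathrm a}$) come with sensing densities $p_{i,j}(d\mid r_{i,j})$ and $p_{i,k,\mathrm a}(e\mid v_{i,k})$ that are log-concave functions of the distances $d,e\ge 0$. For an edge put $z_{i,j}=(Y_{ii},Y_{jj},Y_{ij},\delta_{i,j},d_{i,j},x_i^{\mathsf T},x_j^{\mathsf T})^{\mathsf T}\in\mathbb R^{9}$, where $z_{i,j}$ and $z_{j,i}$ are the same vector, and for a node put $p_i=(\epsilon_i^{\mathsf T},e_i^{\mathsf T},Y_{ii},x_i^{\mathsf T})^{\mathsf T}$. Let $\mathcal Z_{i,j}$ be the set of $z_{i,j}$ with $Y_{ii}+Y_{jj}-2Y_{ij}=\delta_{i,j}\ge 0$, $d_{i,j}\ge0$, $\begin{pmatrix}1&d_{i,j}\\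 d_{i,j}&\delta_{i,j}\end{pmatrix}\succeq0$ and $\begin{pmatrix} I_2&x_i&x_j\\ x_i^{\mathsf T}&Y_{ii}&Y_{ij}\\ x_j^{\mathsf T}&Y_{ij}&Y_{jj}\end{pmatrix}\succeq0$. Let $\mathcal P_i$ be the set of $p_i$ with $Y_{ii}-2x_i^{\mathsf T}a_k+\|a_k\|^2=\epsilon_{i,k}\ge0$, $e_{i,k}\ge0$, $\begin{pmatrix}1&e_{i,k}\\ e_{i,k}&\epsilon_{i,k}\end{pmatrix}\succeq0$ for all $k\in\mathcal N_{i,\mathrm a}$. Consider the convex problem $$\min\ \sum_{i\in\mathcal V}f_i(y_i,p_i)\quad\text{s.t. } y_{i,j}^i,\,y_{i,j}^j\in\mathcal Z_{i,j},\quad p_i\in\mathcal P_i,\quad y_{i,j}^i=z_{i,j}=y_{i,j}^j,$$ where $y_i=(y_{i,j}^i)_{j\in\mathcal N_i}$ are the copies of the edge vectors held by node $i$ (the variables $Y_{ii},x_i$ are common to all $y_{i,j}^i$, $j\in\mathcal N_i$, and to $p_i$), and $f_i$ is the negative log-likelihood $-\sum_{j\in\mathcal N_i}\alpha_{ij}\ln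 p_{i,j}(d_{i,j}\mid r_{i,j})-\sum_{k\in\mathcal N_{i,\mathrm a}}\ln p_{i,k,\mathrm a}(e_{i,k}\mid v_{i,k})$, the term of each edge being divided between its end points ($\alpha_{ij},\alpha_{ji}\ge0$, $\alpha_{ij}+\alpha_{ji}=1$). Assume that this problem has a solution $q^*=(y^*,p^*,z^*)$ with Lagrange multipliers $\lambda^*=(\lambda_{i,j}^{i*},\lambda_{i,j}^{j*})$. For $\rho>0$ let $$\mathcal L_i(y_i,p_i,z_i,\lambda_i)=f_i(y_i,p_i)+\sum_{j\in\mathcal N_i}\Big[\lambda_{i,j}^{i\,\mathsf T}y_{i,j}^i+\tfrac\rho2\|y_{i,j}^i-z_{i,j}\|_2^2\Big].$$ **Algorithm (distributed ADMM).** Start from $y^{(0)}=p^{(0)}=z^{(0)}=\lambda^{(0)}=0$. In each iteration, node $i$ (1) lets $(y_i^{(t+1)},p_i^{(t+1)})$ be a minimizer of $\mathcal L_i(\cdot,\cdot,z_i^{(t)},\lambda_i^{(t)})$ over its constraint set; (2) sends $y_{i,j}^{i\,(t+1)}$ to each $j\in\mathcal N_i$; (3) sets $z_{i,j}^{(t+1)}=\tfrac12(y_{i,j}^{i\,(t+1)}+y_{i,j}^{j\,(t+1)})$;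 (4) sets $\lambda_{i,j}^{i\,(t+1)}=\lambda_{i,j}^{i\,(t)}+\rho\,(y_{i,j}^{i\,(t+1)}-z_{i,j}^{(t+1)})$. With the running averages $\bar q_{i,t}=\frac1t\sum_{\kappa=1}^{t}q_i^{(\kappa)}$ of the vectors $q_i^{(\kappa)}=(y_i^{(\kappa)},p_i^{(\kappa)},z_i^{(\kappa)})$ generated in the first $t\ge1$ iterations, the average local accuracy $\eta>0$ is reached after $t$ iterations if $$0\le\frac1n\sum_{i\in\mathcal V}\big(\mathcal L_i(\bar q_{i,t},\lambda_i^{*})-\mathcal L_i(q_i^*,\lambda_i^{*})\big)\le\eta .$$ **Corollary 1.** Put $t_\eta=\max_{i\in\mathcal V}\Big\lceil\frac1{2\rho\eta}\big(\rho^2\|z_i^*\|_2^2+\|\lambda_i^{*}\|_2^2\big)+1\Big\rceil$, where $z_i^*$ and $\lambda_i^*$ stack the $z_{i,j}^*$ and $\lambda_{i,j}^{i*}$, $j\in\mathcal N_i$. Then, for every node $i$, the number $c_i$ of scalars that node $i$ has sent after $t$ iterations is $9|\mathcal N_i|\,t$, and the accuracy $\eta$ is reached whenever $t\ge 1$ and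 $c_i\ge 9|\mathcal N_i|\,t_\eta$. This bound does not depend on the network size $n$: if $\rho^2\|z_j^*\|_2^2+\|\lambda_j^*\|_2^2\le R$ for all $j$, it is at most $9|\mathcal N_i|\lceil R/(2\rho\eta)+1\rceil$. -/

import Mathlib

open scoped BigOperators Matrix

namespace SNL

noncomputable section

/-! Edge vectors `(Y_ii, Y_jj, Y_ij, δ_ij, d_ij, x_i, x_j) ∈ ℝ^(5+2D)`. -/

/-- The `5 + 2D` coordinates of an edge vector of the edge `{i, j}`, written with node `i` first. -/
abbrev EdgeCoord (D : ℕ) : Type := Fin 5 ⊕ (Fin D ⊕ Fin D)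

/-- Edge vectors, with the Euclidean norm. An edge vector carried by the ordered pair `(i, j)` lists
the coordinates of the edge `{i, j}` with those of `i` before those of `j`. -/
abbrev EdgeVec (D : ℕ) : Type := EuclideanSpace ℝ (EdgeCoord D)

namespace EdgeVec

variable {D : ℕ}

/-- `Y_ii` -/
def gramSelf (u : EdgeVec D) : ℝ := u (Sum.inl 0)
/-- `Y_jj` -/
def gramOther (u : EdgeVec D) : ℝ := u (Sum.inl 1)
/-- `Y_ij` -/
def gramCross (u : EdgeVec D) : ℝ := u (Sum.inl 2)
/-- `δ_ij`, the squared distance variable -/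
def sqDist (u : EdgeVec D) : ℝ := u (Sum.inl 3)
/-- `d_ij`, the distance variable -/
def dist (u : EdgeVec D) : ℝ := u (Sum.inl 4)
/-- `x_i` -/
def posSelf (u : EdgeVec D) : Fin D → ℝ := fun a => u (Sum.inr (Sum.inl a))
/-- `x_j` -/
def posOther (u : EdgeVec D) : Fin D → ℝ := fun a => u (Sum.inr (Sum.inr a))

/-- The exchange of the roles of the two end points on coordinates. -/
def swapCoord (D : ℕ) : EdgeCoord D ≃ EdgeCoord D :=
  Equiv.sumCongr (Equiv.swap 0 1) (Equiv.sumComm (Fin D) (Fin D))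

/-- The same edge vector, rewritten with the other end point first
(`Y_ii ↔ Y_jj`, `x_i ↔ x_j`, the other coordinates unchanged). -/
def swap : EdgeVec D ≃ₗᵢ[ℝ] EdgeVec D :=
  LinearIsometryEquiv.piLpCongrLeft 2 ℝ ℝ (swapCoord D)

/-- The number of scalars of which an edge vector consists. -/
def numScalars (_u : EdgeVec D) : ℕ := Fintype.card (EdgeCoord D)

/-- The constraint set of an edge: `Y_ii + Y_jj - 2 Y_ij = δ`, `δ ≥ 0`, `d ≥ 0`,
`(1 d; d δ) ⪰ 0`, and the edge based matrix inequality on `(I_D, x_i, x_j; Y)`. -/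
def IsEdgeFeasible (u : EdgeVec D) : Prop :=
  u.gramSelf + u.gramOther - 2 * u.gramCross = u.sqDist ∧
  0 ≤ u.sqDist ∧
  0 ≤ u.dist ∧
  (!![1, u.dist; u.dist, u.sqDist] : Matrix (Fin 2) (Fin 2) ℝ).PosSemidef ∧
  (Matrix.fromBlocks (1 : Matrix (Fin D) (Fin D) ℝ)
      (Matrix.of fun a => ![u.posSelf a, u.posOther a])
      (Matrix.of fun a => ![u.posSelf a, u.posOther a])ᵀ
      !![u.gramSelf, u.gramCross; u.gramCross, u.gramOther]).PosSemidef

end EdgeVec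

/-! Local vectors `p_i = (ε_i, e_i, Y_ii, x_i)`. -/

/-- The local vector of a node: squared anchor distances, anchor distances, `Y_ii`, `x_i`.
Only the entries of anchors that neighbor the node are ever used. -/
abbrev AnchorVec (K : Type*) (D : ℕ) : Type _ := (K → ℝ) × (K → ℝ) × ℝ × (Fin D → ℝ)

namespace AnchorVec

variable {K : Type*} {D : ℕ}

/-- `ε_{i,k}` -/
def sqDist (p : AnchorVec K D) : K → ℝ := p.1
/-- `e_{i,k}` -/
def dist (p : AnchorVec K D) : K → ℝ := p.2.1
/-- `Y_ii` -/
def gram (p : AnchorVec K D) : ℝ := p.2.2.1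
/-- `x_i` -/
def pos (p : AnchorVec K D) : Fin D → ℝ := p.2.2.2

end AnchorVec

/-- A function is log-concave on the half line `[0, ∞)`; zero values are allowed. -/
def IsLogConcave (g : ℝ → ℝ) : Prop :=
  (∀ x, 0 ≤ x → 0 ≤ g x) ∧
  ∀ x y a b : ℝ, 0 ≤ x → 0 ≤ y → 0 ≤ a → 0 ≤ b → a + b = 1 →
    g x ^ a * g y ^ b ≤ g (a * x + b * y)

/-- The data of a localization problem in `ℝ^D` with sensor nodes `V` and anchors `K`. -/
structure Network (V K : Type*) (D : ℕ) where
  /-- the graph of the inter-sensor range measurements -/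
  graph : SimpleGraph V
  /-- the anchors that neighbor a node -/
  anchorNbrs : V → Finset K
  /-- the anchor positions -/
  anchorPos : K → Fin D → ℝ
  /-- the inter-sensor range measurements `r_{i,j}`, one for each unordered pair -/
  range : Sym2 V → ℝ
  /-- the anchor range measurements `v_{i,k}` -/
  anchorRange : V → K → ℝ
  /-- the inter-sensor sensing density: `edgePDF s(i,j) d r` is `p_{i,j}(d | r)` -/
  edgePDF : Sym2 V → ℝ → ℝ → ℝ
  /-- the anchor-sensor sensing density: `anchorPDF i k e v` is `p_{i,k,a}(e | v)` -/
  anchorPDF : V → K → ℝ → ℝ → ℝ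
  /-- the fraction of the cost term of the edge `{i, j}` that is put into the cost of node `i` -/
  share : V → V → ℝ
  share_nonneg : ∀ i j, graph.Adj i j → 0 ≤ share i j
  share_add : ∀ i j, graph.Adj i j → share i j + share j i = 1

namespace Network

variable {V K : Type*} [Fintype V] {D : ℕ} (N : Network V K D)

open Classical in
/-- The set `N_i` of the neighboring sensor nodes of `i`. -/
def nbrs (i : V) : Finset V := Finset.univ.filter fun j => N.graph.Adj i j

/-- The sensing densities are log-concave functions of the unknown distances. -/
def HasLogConcavePDFs : Prop :=
  (∀ i j, N.graph.Adj i j → IsLogConcave fun d => N.edgePDF s(i, j) d (N.range s(i, j))) ∧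
  ∀ i, ∀ k ∈ N.anchorNbrs i, IsLogConcave fun e => N.anchorPDF i k e (N.anchorRange i k)

/-- The constraints on the local vector of node `i`: for each neighboring anchor `k`,
`Y_ii - 2 x_iᵀ a_k + ‖a_k‖² = ε`, `ε ≥ 0`, `e ≥ 0`, `(1 e; e ε) ⪰ 0`. -/
def IsAnchorFeasible (i : V) (p : AnchorVec K D) : Prop :=
  ∀ k ∈ N.anchorNbrs i,
    p.gram - 2 * (p.pos ⬝ᵥ N.anchorPos k) + N.anchorPos k ⬝ᵥ N.anchorPos k = p.sqDist k ∧
    0 ≤ p.sqDist k ∧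
    0 ≤ p.dist k ∧
    (!![1, p.dist k; p.dist k, p.sqDist k] : Matrix (Fin 2) (Fin 2) ℝ).PosSemidef

/-- The constraints on the variables `(y_i^i, p_i)` of node `i`; `y j` is the copy that `i` has of
the vector of the edge `{i, j}`. The variables `Y_ii` and `x_i` occur in all these vectors and are
the same variables in each of them. -/
def IsNodeFeasible (i : V) (y : V → EdgeVec D) (p : AnchorVec K D) : Prop :=
  (∀ j ∈ N.nbrs i, (y j).IsEdgeFeasible ∧ (y j).gramSelf = p.gram ∧ (y j).posSelf = p.pos) ∧
  N.IsAnchorFeasible i p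

/-- The cost `f_i` takes the value `+∞` where a density vanishes; it is finite here. -/
def IsFiniteCost (i : V) (y : V → EdgeVec D) (p : AnchorVec K D) : Prop :=
  (∀ j ∈ N.nbrs i, N.share i j ≠ 0 → 0 < N.edgePDF s(i, j) (y j).dist (N.range s(i, j))) ∧
  ∀ k ∈ N.anchorNbrs i, 0 < N.anchorPDF i k (p.dist k) (N.anchorRange i k)

/-- Feasible points of node `i` with finite cost. -/
def IsAdmissible (i : V) (y : V → EdgeVec D) (p : AnchorVec K D) : Prop :=
  N.IsNodeFeasible i y p ∧ N.IsFiniteCost i y p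

/-- The cost `f_i` of node `i` (meaningful where it is finite): the negative log-likelihood, the
term of each edge being divided between its two end points. -/
def nodeCost (i : V) (y : V → EdgeVec D) (p : AnchorVec K D) : ℝ :=
  -(∑ j ∈ N.nbrs i,
      N.share i j * Real.log (N.edgePDF s(i, j) (y j).dist (N.range s(i, j))) +
    ∑ k ∈ N.anchorNbrs i, Real.log (N.anchorPDF i k (p.dist k) (N.anchorRange i k)))

/-- The local Lagrangian
`L_i = f_i(y_i, p_i) + ∑_{j ∈ N_i} [λ_{ij}ᵀ y_{ij} + ρ/2 ‖y_{ij} - z_{ij}‖²]`. -/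
def localLagrangian (ρ : ℝ) (i : V) (y : V → EdgeVec D) (p : AnchorVec K D)
    (z lam : V → EdgeVec D) : ℝ :=
  N.nodeCost i y p +
    ∑ j ∈ N.nbrs i, (inner ℝ (lam j) (y j) + ρ / 2 * ‖y j - z j‖ ^ 2)

/-- The (unregularized) Lagrangian of the problem
`min ∑ f_i(y_i^i, p_i)` subject to `y_{ij}^i = z_{ij}`, `y_{ij}^j = z_{ij}` and the constraints of
the nodes. The multiplier `lam i j` belongs to the copy of the edge `{i, j}` that `i` has. -/
def lagrangian (y : V → V → EdgeVec D) (p : V → AnchorVec K D)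
    (z lam : V → V → EdgeVec D) : ℝ :=
  ∑ i, N.nodeCost i (y i) (p i) +
    ∑ i, ∑ j ∈ N.nbrs i, inner ℝ (lam i j) (y i j - z i j)

/-- `z i j` and `z j i` are one and the same vector of the edge `{i, j}`, written from its two
ends. -/
def IsShared (z : V → V → EdgeVec D) : Prop :=
  ∀ i, ∀ j ∈ N.nbrs i, z j i = EdgeVec.swap (z i j)

/-- A primal-dual solution `(q*, λ*)`, `q* = (y*, p*, z*)`, of the problem. -/
structure PrimalDual (V K : Type*) (D : ℕ) where
  y : V → V → EdgeVec D
  p : V → AnchorVec K D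
  z : V → V → EdgeVec D
  lam : V → V → EdgeVec D

/-- `(q*, λ*)` solves the problem: `q*` is feasible with finite cost, and `q*` minimizes the
Lagrangian with multiplier `λ*`, so that `q*` is optimal and `λ*` is a vector of Lagrange
multipliers. -/
structure IsSolution (s : PrimalDual V K D) : Prop where
  admissible : ∀ i, N.IsAdmissible i (s.y i) (s.p i)
  shared : N.IsShared s.z
  coupling : ∀ i, ∀ j ∈ N.nbrs i, s.y i j = s.z i j
  minimizes : ∀ (y : V → V → EdgeVec D) (p : V → AnchorVec K D) (z : V → V → EdgeVec D),
    (∀ i, N.IsAdmissible i (y i) (p i)) → N.IsShared z →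
    N.lagrangian s.y s.p s.z s.lam ≤ N.lagrangian y p z s.lam

/-- The variables of an execution of the distributed algorithm. For `X = y, z, lam`, the vector
`X t i j` is the one that node `i` holds for its edge `{i, j}` after `t` iterations; `msg t i j` is
the message that node `i` sends to its neighbor `j` in the iteration that leads from `t` to
`t + 1`. -/
structure Trace (V K : Type*) (D : ℕ) where
  y : ℕ → V → V → EdgeVec D
  p : ℕ → V → AnchorVec K D
  z : ℕ → V → V → EdgeVec D
  lam : ℕ → V → V → EdgeVec D
  msg : ℕ → V → V → EdgeVec D

/-- The execution is one of the distributed alternating direction method of multipliers with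
penalty `ρ`, started at zero, with exact solution of the local problems. -/
structure IsRun (ρ : ℝ) (tr : Trace V K D) : Prop where
  init_y : ∀ i, ∀ j ∈ N.nbrs i, tr.y 0 i j = 0
  init_p : ∀ i, tr.p 0 i = 0
  init_z : ∀ i, ∀ j ∈ N.nbrs i, tr.z 0 i j = 0
  init_lam : ∀ i, ∀ j ∈ N.nbrs i, tr.lam 0 i j = 0
  /-- each node solves its local convex program -/
  update_mem : ∀ t i, N.IsAdmissible i (tr.y (t + 1) i) (tr.p (t + 1) i)
  update_min : ∀ t i (y : V → EdgeVec D) (p : AnchorVec K D), N.IsAdmissible i y p →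
    N.localLagrangian ρ i (tr.y (t + 1) i) (tr.p (t + 1) i) (tr.z t i) (tr.lam t i) ≤
      N.localLagrangian ρ i y p (tr.z t i) (tr.lam t i)
  /-- each node sends its new edge vector to each neighbor -/
  send : ∀ t i, ∀ j ∈ N.nbrs i, tr.msg t i j = tr.y (t + 1) i j
  /-- each node averages its own edge vector with the one it receives -/
  update_z : ∀ t i, ∀ j ∈ N.nbrs i,
    tr.z (t + 1) i j = (1 / 2 : ℝ) • (tr.y (t + 1) i j + EdgeVec.swap (tr.msg t j i))
  update_lam : ∀ t i, ∀ j ∈ N.nbrs i,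
    tr.lam (t + 1) i j = tr.lam t i j + ρ • (tr.y (t + 1) i j - tr.z (t + 1) i j)

/-- The number of scalars that node `i` sends in the first `T` iterations. -/
def commCost (tr : Trace V K D) (i : V) (T : ℕ) : ℕ :=
  ∑ t ∈ Finset.range T, ∑ j ∈ N.nbrs i, (tr.msg t i j).numScalars

/-- The running average of the vectors generated in the first `T ≥ 1` iterations. -/
def runningAvg {E : Type*} [AddCommGroup E] [Module ℝ E] (u : ℕ → E) (T : ℕ) : E :=
  (1 / (T : ℝ)) • ∑ t ∈ Finset.range T, u (t + 1)

/-- The average local error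
`(1/n) ∑_i (L_i(q̄_i, λ_i*) - L_i(q_i*, λ_i*))` after `T` iterations. -/
def avgLocalError (ρ : ℝ) (s : PrimalDual V K D) (tr : Trace V K D) (T : ℕ) : ℝ :=
  1 / (Fintype.card V : ℝ) *
    ∑ i, (N.localLagrangian ρ i (runningAvg (fun t => tr.y t i) T)
            (runningAvg (fun t => tr.p t i) T) (runningAvg (fun t => tr.z t i) T) (s.lam i) -
          N.localLagrangian ρ i (s.y i) (s.p i) (s.z i) (s.lam i))

/-- The average local accuracy `η` is reached after `T` iterations: the costs at the running
averages are finite and the average local error lies in `[0, η]`. -/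
def ReachesAccuracy (ρ η : ℝ) (s : PrimalDual V K D) (tr : Trace V K D) (T : ℕ) : Prop :=
  (∀ i, N.IsFiniteCost i (runningAvg (fun t => tr.y t i) T) (runningAvg (fun t => tr.p t i) T)) ∧
  0 ≤ N.avgLocalError ρ s tr T ∧ N.avgLocalError ρ s tr T ≤ η

/-- `ρ² ‖z_i*‖² + ‖λ_i*‖²`, with the stacked vectors of node `i`. -/
def localInitialError (ρ : ℝ) (s : PrimalDual V K D) (i : V) : ℝ :=
  ρ ^ 2 * ∑ j ∈ N.nbrs i, ‖s.z i j‖ ^ 2 + ∑ j ∈ N.nbrs i, ‖s.lam i j‖ ^ 2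

/-- `t_η = max_i ⌈(ρ² ‖z_i*‖² + ‖λ_i*‖²) / (2 ρ η) + 1⌉`. -/
def iterationBound (ρ η : ℝ) (s : PrimalDual V K D) : ℕ :=
  Finset.univ.sup fun i => ⌈1 / (2 * ρ * η) * N.localInitialError ρ s i + 1⌉₊

end Network

end

end SNL

namespace SNL

/-! This is the ergodic O(1/T) analysis of ADMM. Log-concavity makes each node's problem convex, so
exact local minimization yields a variational inequality (`nodeCost_sub_le`). A purely algebraic
identity (`admm_step_identity`) rewrites its right-hand side, per edge copy, as a decrease of `‖λ* -
λ‖² / (2ρ) + ρ/2 ‖z* - z‖²`, minus a square, plus cross terms.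

The cross terms vanish only after summation over both ends of every edge. The averaged `z` agree at
the two ends, while the residuals `y - z`, and hence the multipliers started at zero, are opposite
there (`IsOpposite.sum_inner_eq_zero`). The optimal multipliers `λ*` are orthogonal to all shared
vectors because the Lagrangian is affine in `z` and has a minimum
(`IsSolution.sum_inner_lam_eq_zero`).

The Lagrangian gaps therefore telescope, with total at most the initial Lyapunov value, which is the
sum of the local initial errors over `2ρ`. Jensen's inequality carries this bound to the running
averages, and the saddle point property gives the lower bound 0. Averaging over nodes cancels the
factor `n`, so a bound on every local initial error suffices. Each iteration costs node `i` exactly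
`9 |N_i|` scalars, so iterations convert into communication. -/

/-! ### Convexity of the local problems -/

theorem IsLogConcave.log_concave {g : ℝ → ℝ} (hg : IsLogConcave g) {x y a b : ℝ}
    (hx : 0 ≤ x) (hy : 0 ≤ y) (ha : 0 ≤ a) (hb : 0 ≤ b) (hab : a + b = 1)
    (hgx : 0 < g x) (hgy : 0 < g y) :
    0 < g (a * x + b * y) ∧
      a * Real.log (g x) + b * Real.log (g y) ≤ Real.log (g (a * x + b * y)) := by
  have h := hg.2 x y a b hx hy ha hb hab
  have hxa := Real.rpow_pos_of_pos hgx a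
  have hyb := Real.rpow_pos_of_pos hgy b
  refine ⟨(mul_pos hxa hyb).trans_le h, ?_⟩
  rw [← Real.log_rpow hgx, ← Real.log_rpow hgy, ← Real.log_mul hxa.ne' hyb.ne']
  exact Real.log_le_log (mul_pos hxa hyb) h

theorem EdgeVec.IsEdgeFeasible.convexComb {D : ℕ} {u v : EdgeVec D} (hu : u.IsEdgeFeasible)
    (hv : v.IsEdgeFeasible) {a b : ℝ} (ha : 0 ≤ a) (hb : 0 ≤ b) (hab : a + b = 1) :
    (a • u + b • v).IsEdgeFeasible := by
  obtain ⟨hu1, hu2, hu3, hu4, hu5⟩ := hu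
  obtain ⟨hv1, hv2, hv3, hv4, hv5⟩ := hv
  refine ⟨?_, ?_, ?_, ?_, ?_⟩
  · simp only [gramSelf, gramOther, gramCross, sqDist, PiLp.add_apply, PiLp.smul_apply,
      smul_eq_mul] at hu1 hv1 ⊢
    linear_combination a * hu1 + b * hv1
  · exact add_nonneg (mul_nonneg ha hu2) (mul_nonneg hb hv2)
  · exact add_nonneg (mul_nonneg ha hu3) (mul_nonneg hb hv3)
  -- The matrices depend affinely on the vector; `hab` matches their constant entries.
  · convert (hu4.smul ha).add (hv4.smul hb) using 1
    ext r c
    fin_cases r <;> fin_cases c <;> simp [dist, sqDist, hab]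
  · convert (hu5.smul ha).add (hv5.smul hb) using 1
    ext r c
    rcases r with r | r <;> rcases c with c | c
    · simp [Matrix.fromBlocks, ← add_mul, hab]
    · fin_cases c <;> simp [Matrix.fromBlocks, posSelf, posOther]
    · fin_cases r <;> simp [Matrix.fromBlocks, posSelf, posOther]
    · fin_cases r <;> fin_cases c <;>
        simp [Matrix.fromBlocks, gramSelf, gramOther, gramCross]

theorem norm_sq_convexComb_le {E : Type*} [NormedAddCommGroup E] [InnerProductSpace ℝ E] (u v : E)
    {a b : ℝ} (ha : 0 ≤ a) (hb : 0 ≤ b) (hab : a + b = 1) :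
    ‖a • u + b • v‖ ^ 2 ≤ a * ‖u‖ ^ 2 + b * ‖v‖ ^ 2 := by
  have h := ((convexOn_norm (convex_univ (E := E) (𝕜 := ℝ))).pow (fun _ _ => norm_nonneg _) 2).2
    (Set.mem_univ u) (Set.mem_univ v) ha hb hab
  simpa using h

/-- Divide by `θ` and let `θ → 0`. Instead of a limit, the proof uses one `θ` so small that `θ |b| ≤
|a| / 2`, which contradicts `a < 0`. -/
theorem nonneg_of_forall_quadratic {a b : ℝ}
    (h : ∀ θ : ℝ, 0 < θ → θ ≤ 1 → 0 ≤ θ * a + θ ^ 2 * b) : 0 ≤ a := by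
  by_contra! ha
  have ha' : 0 < |a| := abs_pos.2 ha.ne
  have hc : 0 < |b| + |a| := by positivity
  have hθ : 0 < |a| / (2 * (|b| + |a|)) := by positivity
  have hθ1 : |a| / (2 * (|b| + |a|)) ≤ 1 := by
    rw [div_le_one (by positivity)]
    linarith [abs_nonneg b, abs_nonneg a]
  have h1 := h _ hθ hθ1
  set θ := |a| / (2 * (|b| + |a|)) with hdef
  have h2 : θ * (2 * (|b| + |a|)) = |a| := by
    rw [hdef]; field_simp
  have h3 : 0 ≤ a + θ * b := by
    by_contra! h4
    nlinarith [mul_pos_of_neg_of_neg h4 (neg_neg_of_pos hθ)]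
  have h5 : θ * b ≤ θ * |b| := mul_le_mul_of_nonneg_left (le_abs_self b) hθ.le
  rw [abs_of_neg ha] at h2
  nlinarith

namespace Network

variable {V K : Type*} {D : ℕ} {N : Network V K D}

theorem IsAnchorFeasible.convexComb {i : V} {p q : AnchorVec K D} (hp : N.IsAnchorFeasible i p)
    (hq : N.IsAnchorFeasible i q) {a b : ℝ} (ha : 0 ≤ a) (hb : 0 ≤ b) (hab : a + b = 1) :
    N.IsAnchorFeasible i (a • p + b • q) := by
  intro k hk
  obtain ⟨hp1, hp2, hp3, hp4⟩ := hp k hk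
  obtain ⟨hq1, hq2, hq3, hq4⟩ := hq k hk
  refine ⟨?_, ?_, ?_, ?_⟩
  · have hpos : (a • p + b • q).pos = a • p.pos + b • q.pos := rfl
    have hgram : (a • p + b • q).gram = a * p.gram + b * q.gram := rfl
    have hsq : (a • p + b • q).sqDist k = a * p.sqDist k + b * q.sqDist k := rfl
    rw [hpos, hgram, hsq, add_dotProduct, smul_dotProduct, smul_dotProduct, smul_eq_mul,
      smul_eq_mul]
    linear_combination a * hp1 + b * hq1 - (N.anchorPos k ⬝ᵥ N.anchorPos k) * hab
  · exact add_nonneg (mul_nonneg ha hp2) (mul_nonneg hb hq2)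
  · exact add_nonneg (mul_nonneg ha hp3) (mul_nonneg hb hq3)
  · convert (hp4.smul ha).add (hq4.smul hb) using 1
    ext r c
    fin_cases r <;> fin_cases c <;> simp [AnchorVec.dist, AnchorVec.sqDist, hab]

variable [Fintype V]

theorem mem_nbrs {i j : V} : j ∈ N.nbrs i ↔ N.graph.Adj i j := by
  simp [nbrs]

theorem mem_nbrs_comm {i j : V} : j ∈ N.nbrs i ↔ i ∈ N.nbrs j := by
  rw [mem_nbrs, mem_nbrs, SimpleGraph.adj_comm]

theorem IsNodeFeasible.convexComb {i : V} {y y' : V → EdgeVec D} {p p' : AnchorVec K D}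
    (h : N.IsNodeFeasible i y p) (h' : N.IsNodeFeasible i y' p') {a b : ℝ} (ha : 0 ≤ a)
    (hb : 0 ≤ b) (hab : a + b = 1) :
    N.IsNodeFeasible i (a • y + b • y') (a • p + b • p') := by
  refine ⟨fun j hj => ?_, h.2.convexComb h'.2 ha hb hab⟩
  obtain ⟨h1, h2, h3⟩ := h.1 j hj
  obtain ⟨h1', h2', h3'⟩ := h'.1 j hj
  refine ⟨h1.convexComb h1' ha hb hab, ?_, ?_⟩
  · change a * (y j).gramSelf + b * (y' j).gramSelf = a * p.gram + b * p'.gram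
    rw [h2, h2']
  · change a • (y j).posSelf + b • (y' j).posSelf = a • p.pos + b • p'.pos
    rw [h3, h3']

/-- Feasibility supplies the nonnegative distances that log-concavity on the half line requires.
Finiteness of the cost must be propagated together with the inequality, since `Real.log` has a junk
value where a density vanishes. -/
theorem IsAdmissible.convexComb (hpdf : N.HasLogConcavePDFs) {i : V} {y y' : V → EdgeVec D}
    {p p' : AnchorVec K D} (h : N.IsAdmissible i y p) (h' : N.IsAdmissible i y' p') {a b : ℝ}
    (ha : 0 ≤ a) (hb : 0 ≤ b) (hab : a + b = 1) :
    N.IsAdmissible i (a • y + b • y') (a • p + b • p') ∧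
      N.nodeCost i (a • y + b • y') (a • p + b • p') ≤
        a * N.nodeCost i y p + b * N.nodeCost i y' p' := by
  have hedge : ∀ j ∈ N.nbrs i, N.share i j ≠ 0 → _ := fun j hj hs =>
    (hpdf.1 i j (mem_nbrs.1 hj)).log_concave (h.1.1 j hj).1.2.2.1 (h'.1.1 j hj).1.2.2.1 ha hb hab
      (h.2.1 j hj hs) (h'.2.1 j hj hs)
  have hanchor : ∀ k ∈ N.anchorNbrs i, _ := fun k hk =>
    (hpdf.2 i k hk).log_concave (h.1.2 k hk).2.2.1 (h'.1.2 k hk).2.2.1 ha hb hab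
      (h.2.2 k hk) (h'.2.2 k hk)
  refine ⟨⟨h.1.convexComb h'.1 ha hb hab, fun j hj hs => (hedge j hj hs).1,
    fun k hk => (hanchor k hk).1⟩, ?_⟩
  unfold nodeCost
  have h1 := Finset.sum_le_sum fun k hk => (hanchor k hk).2
  have h2 : ∑ j ∈ N.nbrs i,
      (a * (N.share i j * Real.log (N.edgePDF s(i, j) (y j).dist (N.range s(i, j)))) +
        b * (N.share i j * Real.log (N.edgePDF s(i, j) (y' j).dist (N.range s(i, j))))) ≤
      ∑ j ∈ N.nbrs i, N.share i j *
        Real.log (N.edgePDF s(i, j) ((a • y + b • y') j).dist (N.range s(i, j))) := by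
    refine Finset.sum_le_sum fun j hj => ?_
    -- With share zero the density may vanish at this copy, but the term is then absent from the
    -- cost.
    by_cases hs : N.share i j = 0
    · simp [hs]
    · have := mul_le_mul_of_nonneg_left (hedge j hj hs).2 (N.share_nonneg i j (mem_nbrs.1 hj))
      refine le_trans (le_of_eq ?_) this
      ring
  rw [Finset.sum_add_distrib, ← Finset.mul_sum, ← Finset.mul_sum] at h1 h2
  have h3 : ∑ k ∈ N.anchorNbrs i, Real.log (N.anchorPDF i k
        (a * p.dist k + b * p'.dist k) (N.anchorRange i k)) =
      ∑ k ∈ N.anchorNbrs i, Real.log (N.anchorPDF i k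
        ((a • p + b • p').dist k) (N.anchorRange i k)) := rfl
  linarith

/-- The admissible variables of node `i`, together with arbitrary edge vectors `z_i`. -/
def admissibleSet (N : Network V K D) (i : V) :
    Set ((V → EdgeVec D) × AnchorVec K D × (V → EdgeVec D)) :=
  {w | N.IsAdmissible i w.1 w.2.1}

/-- Convexity is needed jointly in `(y, p, z)`, because the `z` are averaged too; the penalty is a
square of the linear map `y - z`. -/
theorem convexOn_localLagrangian (hpdf : N.HasLogConcavePDFs) {ρ : ℝ} (hρ : 0 ≤ ρ) (i : V)
    (lam : V → EdgeVec D) :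
    ConvexOn ℝ (N.admissibleSet i) fun w => N.localLagrangian ρ i w.1 w.2.1 w.2.2 lam := by
  refine ⟨fun w hw w' hw' a b ha hb hab => (IsAdmissible.convexComb hpdf hw hw' ha hb hab).1,
    fun w hw w' hw' a b ha hb hab => ?_⟩
  have h1 := (IsAdmissible.convexComb hpdf hw hw' ha hb hab).2
  have h2 : ∑ j ∈ N.nbrs i, (inner ℝ (lam j) ((a • w + b • w').1 j) +
        ρ / 2 * ‖(a • w + b • w').1 j - (a • w + b • w').2.2 j‖ ^ 2) ≤
      a * ∑ j ∈ N.nbrs i, (inner ℝ (lam j) (w.1 j) + ρ / 2 * ‖w.1 j - w.2.2 j‖ ^ 2) +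
        b * ∑ j ∈ N.nbrs i, (inner ℝ (lam j) (w'.1 j) + ρ / 2 * ‖w'.1 j - w'.2.2 j‖ ^ 2) := by
    rw [Finset.mul_sum, Finset.mul_sum, ← Finset.sum_add_distrib]
    refine Finset.sum_le_sum fun j _ => ?_
    have h3 := mul_le_mul_of_nonneg_left
      (norm_sq_convexComb_le (w.1 j - w.2.2 j) (w'.1 j - w'.2.2 j) ha hb hab)
      (show 0 ≤ ρ / 2 by positivity)
    have h4 : (a • w + b • w').1 j - (a • w + b • w').2.2 j =
        a • (w.1 j - w.2.2 j) + b • (w'.1 j - w'.2.2 j) := by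
      simp only [Prod.fst_add, Prod.snd_add, Prod.smul_fst, Prod.smul_snd, Pi.add_apply,
        Pi.smul_apply]
      module
    have h5 : inner ℝ (lam j) ((a • w + b • w').1 j) =
        a * inner ℝ (lam j) (w.1 j) + b * inner ℝ (lam j) (w'.1 j) := by
      simp [inner_add_right, inner_smul_right]
    rw [h4, h5]
    linarith
  simp only [localLagrangian, smul_eq_mul]
  simp only [Prod.fst_add, Prod.snd_add, Prod.smul_fst, Prod.smul_snd] at h2 ⊢
  linarith

/-- The first order optimality condition of the local program of a node. -/
theorem nodeCost_sub_le (hpdf : N.HasLogConcavePDFs) {ρ : ℝ} {i : V}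
    {y v z lam : V → EdgeVec D} {p q : AnchorVec K D} (hy : N.IsAdmissible i y p)
    (hv : N.IsAdmissible i v q)
    (hmin : ∀ (y' : V → EdgeVec D) (p' : AnchorVec K D), N.IsAdmissible i y' p' →
      N.localLagrangian ρ i y p z lam ≤ N.localLagrangian ρ i y' p' z lam) :
    N.nodeCost i y p - N.nodeCost i v q ≤
      ∑ j ∈ N.nbrs i, inner ℝ (lam j + ρ • (y j - z j)) (v j - y j) := by
  rw [← sub_nonneg]
  -- Moving from the minimizer by a fraction `θ` towards `(v, q)` changes the objective by at most
  -- `θ a + θ² b`. Convexity bounds the cost part, so no differentiability of the densities is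
  -- needed.
  refine nonneg_of_forall_quadratic (b := ∑ j ∈ N.nbrs i, ρ / 2 * ‖v j - y j‖ ^ 2)
    fun θ hθ hθ1 => ?_
  obtain ⟨hadm, hcost⟩ := hy.convexComb hpdf hv (sub_nonneg.2 hθ1) hθ.le (sub_add_cancel 1 θ)
  have h := hmin _ _ hadm
  unfold localLagrangian at h
  have hsum : ∑ j ∈ N.nbrs i, (inner ℝ (lam j) (((1 - θ) • y + θ • v) j) +
        ρ / 2 * ‖((1 - θ) • y + θ • v) j - z j‖ ^ 2) =
      ∑ j ∈ N.nbrs i, (inner ℝ (lam j) (y j) + ρ / 2 * ‖y j - z j‖ ^ 2) +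
      (θ * ∑ j ∈ N.nbrs i, inner ℝ (lam j + ρ • (y j - z j)) (v j - y j) +
        θ ^ 2 * ∑ j ∈ N.nbrs i, ρ / 2 * ‖v j - y j‖ ^ 2) := by
    rw [Finset.mul_sum, Finset.mul_sum, ← Finset.sum_add_distrib, ← Finset.sum_add_distrib]
    refine Finset.sum_congr rfl fun j _ => ?_
    have e1 : ((1 - θ) • y + θ • v) j = y j + θ • (v j - y j) := by
      simp only [Pi.add_apply, Pi.smul_apply]
      module
    have e2 : y j + θ • (v j - y j) - z j = (y j - z j) + θ • (v j - y j) := by abel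
    rw [e1, e2, norm_add_sq_real, inner_add_right, inner_add_left, norm_smul, mul_pow,
      Real.norm_eq_abs, sq_abs]
    simp only [inner_smul_left, inner_smul_right, RCLike.conj_to_real]
    ring
  rw [hsum] at h
  linarith

end Network

end SNL

namespace SNL

/-! ### The algebra of one iteration and the exchange of end points -/

theorem EdgeVec.swap_swap {D : ℕ} (u : EdgeVec D) : EdgeVec.swap (EdgeVec.swap u) = u := by
  ext c
  rcases c with c | c | c
  · fin_cases c <;> rfl
  · rfl
  · rfl

/-- Write `lam + ρ (y' - z) = lam' + ρ (z' - z)` and polarize. The term `‖lam' - lam‖² / (2ρ)` that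
polarization leaves over equals `ρ/2 ‖y' - z'‖²`, so the penalty of the local Lagrangian is absorbed
exactly. -/
theorem admm_step_identity {E : Type*} [NormedAddCommGroup E] [InnerProductSpace ℝ E] {ρ : ℝ}
    (hρ : ρ ≠ 0) (y' z z' zs lam lam' lams : E) (hlam : lam' = lam + ρ • (y' - z')) :
    inner ℝ (lam + ρ • (y' - z)) (zs - y') + inner ℝ lams (y' - zs) + ρ / 2 * ‖y' - z'‖ ^ 2 =
      1 / (2 * ρ) * (‖lams - lam‖ ^ 2 - ‖lams - lam'‖ ^ 2) +
      ρ / 2 * (‖zs - z‖ ^ 2 - ‖zs - z'‖ ^ 2) - ρ / 2 * ‖z' - z‖ ^ 2 +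
      (inner ℝ lam' (zs - z') + inner ℝ lams (z' - zs) - ρ * inner ℝ (y' - z') (z' - z)) := by
  subst hlam
  simp only [← real_inner_self_eq_norm_sq, inner_add_left, inner_add_right, inner_sub_left,
    inner_sub_right, inner_smul_left, inner_smul_right, RCLike.conj_to_real]
  rw [real_inner_comm z' y', real_inner_comm z y', real_inner_comm zs y', real_inner_comm lam y',
    real_inner_comm lams y', real_inner_comm z z', real_inner_comm zs z', real_inner_comm lam z',
    real_inner_comm lams z', real_inner_comm zs z, real_inner_comm lams lam]
  field_simp
  ring

namespace Network

variable {V K : Type*} [Fintype V] {D : ℕ} {N : Network V K D}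

/-- Vectors on the edges whose two versions, written from the two ends, are opposite. -/
def IsOpposite (N : Network V K D) (u : V → V → EdgeVec D) : Prop :=
  ∀ i, ∀ j ∈ N.nbrs i, u j i = -EdgeVec.swap (u i j)

theorem sum_nbrs_comm (F : V → V → ℝ) :
    ∑ i, ∑ j ∈ N.nbrs i, F i j = ∑ i, ∑ j ∈ N.nbrs i, F j i :=
  Finset.sum_comm' fun i j => by simp [mem_nbrs_comm (i := i)]

/-- Since `swap` is an isometry, the contributions of the two ends of each edge cancel. -/
theorem IsOpposite.sum_inner_eq_zero {u z : V → V → EdgeVec D} (hu : N.IsOpposite u)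
    (hz : N.IsShared z) : ∑ i, ∑ j ∈ N.nbrs i, inner ℝ (u i j) (z i j) = 0 := by
  have h : ∑ i, ∑ j ∈ N.nbrs i, inner ℝ (u j i) (z j i) =
      -∑ i, ∑ j ∈ N.nbrs i, inner ℝ (u i j) (z i j) := by
    simp only [← Finset.sum_neg_distrib]
    refine Finset.sum_congr rfl fun i _ => Finset.sum_congr rfl fun j hj => ?_
    rw [hu i j hj, hz i j hj, inner_neg_left, LinearIsometryEquiv.inner_map_map]
  rw [← sum_nbrs_comm fun i j => inner ℝ (u i j) (z i j)] at h
  linarith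

theorem IsShared.add {z w : V → V → EdgeVec D} (hz : N.IsShared z) (hw : N.IsShared w) :
    N.IsShared (fun i j => z i j + w i j) := fun i j hj => by
  simp only [hz i j hj, hw i j hj, map_add]

theorem IsShared.smul {z : V → V → EdgeVec D} (hz : N.IsShared z) (c : ℝ) :
    N.IsShared (fun i j => c • z i j) := fun i j hj => by
  simp only [hz i j hj, map_smul]

theorem IsShared.sub {z w : V → V → EdgeVec D} (hz : N.IsShared z) (hw : N.IsShared w) :
    N.IsShared (fun i j => z i j - w i j) := fun i j hj => by
  simp only [hz i j hj, hw i j hj, map_sub]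

theorem IsShared.sum {ι : Type*} {z : ι → V → V → EdgeVec D} (s : Finset ι)
    (hz : ∀ t ∈ s, N.IsShared (z t)) : N.IsShared (fun i j => ∑ t ∈ s, z t i j) :=
  fun i j hj => by
    simp only [map_sum]
    exact Finset.sum_congr rfl fun t ht => hz t ht i j hj

/-! ### The saddle point property -/

/-- The multipliers are orthogonal to the shared edge vectors. -/
theorem IsSolution.sum_inner_lam_eq_zero {s : PrimalDual V K D} (hs : N.IsSolution s)
    {w : V → V → EdgeVec D} (hw : N.IsShared w) :
    ∑ i, ∑ j ∈ N.nbrs i, inner ℝ (s.lam i j) (w i j) = 0 := by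
  -- Displacing `z*` by `c w` keeps it shared and changes the Lagrangian linearly in `c`; minimality
  -- for both signs of `c` forces the slope to be zero.
  have key (c : ℝ) : c * ∑ i, ∑ j ∈ N.nbrs i, inner ℝ (s.lam i j) (w i j) ≤ 0 := by
    have h := hs.minimizes s.y s.p _ hs.admissible (hs.shared.add (hw.smul c))
    have e : ∀ i j, inner ℝ (s.lam i j) (s.y i j - (s.z i j + c • w i j)) =
        inner ℝ (s.lam i j) (s.y i j - s.z i j) - c * inner ℝ (s.lam i j) (w i j) := by
      intro i j
      rw [← sub_sub, inner_sub_right _ (s.y i j - s.z i j), inner_smul_right]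
    simp only [lagrangian, e, Finset.sum_sub_distrib, ← Finset.mul_sum] at h
    linarith
  linarith [key 1, key (-1)]

theorem IsSolution.lagrangian_eq {s : PrimalDual V K D} (hs : N.IsSolution s) :
    N.lagrangian s.y s.p s.z s.lam = ∑ i, N.nodeCost i (s.y i) (s.p i) := by
  have : ∑ i, ∑ j ∈ N.nbrs i, inner ℝ (s.lam i j) (s.y i j - s.z i j) = 0 :=
    Finset.sum_eq_zero fun i _ => Finset.sum_eq_zero fun j hj => by
      rw [hs.coupling i j hj, sub_self, inner_zero_right]
  rw [lagrangian, this, add_zero]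

/-- For shared `z` the local Lagrangians add up to the augmented Lagrangian. -/
theorem IsSolution.sum_localLagrangian {s : PrimalDual V K D} (hs : N.IsSolution s) (ρ : ℝ)
    (y : V → V → EdgeVec D) (p : V → AnchorVec K D) {z : V → V → EdgeVec D} (hz : N.IsShared z) :
    ∑ i, N.localLagrangian ρ i (y i) (p i) (z i) (s.lam i) =
      N.lagrangian y p z s.lam + ∑ i, ∑ j ∈ N.nbrs i, ρ / 2 * ‖y i j - z i j‖ ^ 2 := by
  have h := hs.sum_inner_lam_eq_zero hz
  simp only [localLagrangian, lagrangian, Finset.sum_add_distrib, inner_sub_right,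
    Finset.sum_sub_distrib, h]
  ring

theorem IsSolution.sum_localLagrangian_self {s : PrimalDual V K D} (hs : N.IsSolution s)
    (ρ : ℝ) : ∑ i, N.localLagrangian ρ i (s.y i) (s.p i) (s.z i) (s.lam i) =
      ∑ i, N.nodeCost i (s.y i) (s.p i) := by
  rw [hs.sum_localLagrangian ρ _ _ hs.shared, hs.lagrangian_eq, add_eq_left]
  exact Finset.sum_eq_zero fun i _ => Finset.sum_eq_zero fun j hj => by
    simp [hs.coupling i j hj]

/-- The solution is a saddle point of the augmented Lagrangian. -/
theorem IsSolution.sum_localLagrangian_le {s : PrimalDual V K D} (hs : N.IsSolution s) {ρ : ℝ}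
    (hρ : 0 ≤ ρ) {y : V → V → EdgeVec D} {p : V → AnchorVec K D} {z : V → V → EdgeVec D}
    (hy : ∀ i, N.IsAdmissible i (y i) (p i)) (hz : N.IsShared z) :
    ∑ i, N.localLagrangian ρ i (s.y i) (s.p i) (s.z i) (s.lam i) ≤
      ∑ i, N.localLagrangian ρ i (y i) (p i) (z i) (s.lam i) := by
  rw [hs.sum_localLagrangian_self, ← hs.lagrangian_eq, hs.sum_localLagrangian ρ y p hz]
  have h1 := hs.minimizes y p z hy hz
  have h2 : 0 ≤ ∑ i, ∑ j ∈ N.nbrs i, ρ / 2 * ‖y i j - z i j‖ ^ 2 :=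
    Finset.sum_nonneg fun i _ => Finset.sum_nonneg fun j _ => by positivity
  linarith

/-! ### Decrease of the Lyapunov function along a run -/

section Run

variable {ρ : ℝ} {tr : Trace V K D}

theorem IsRun.update_z_eq (htr : N.IsRun ρ tr) (t : ℕ) {i j : V} (hj : j ∈ N.nbrs i) :
    tr.z (t + 1) i j = (1 / 2 : ℝ) • (tr.y (t + 1) i j + EdgeVec.swap (tr.y (t + 1) j i)) := by
  rw [htr.update_z t i j hj, htr.send t j i (mem_nbrs_comm.1 hj)]

theorem IsRun.isShared_z (htr : N.IsRun ρ tr) (t : ℕ) : N.IsShared (tr.z t) := by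
  intro i j hj
  cases t with
  | zero => rw [htr.init_z i j hj, htr.init_z j i (mem_nbrs_comm.1 hj), map_zero]
  | succ t =>
    rw [htr.update_z_eq t hj, htr.update_z_eq t (mem_nbrs_comm.1 hj), map_smul, map_add,
      EdgeVec.swap_swap, add_comm]

theorem IsRun.isOpposite_residual (htr : N.IsRun ρ tr) (t : ℕ) :
    N.IsOpposite fun i j => tr.y (t + 1) i j - tr.z (t + 1) i j := by
  intro i j hj
  simp only [htr.update_z_eq t hj, htr.update_z_eq t (mem_nbrs_comm.1 hj), map_smul, map_add,
    map_sub, EdgeVec.swap_swap]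
  module

/-- The multipliers accumulate opposite residuals; the zero start is what makes the induction begin.
-/
theorem IsRun.isOpposite_lam (htr : N.IsRun ρ tr) (t : ℕ) : N.IsOpposite (tr.lam t) := by
  induction t with
  | zero =>
    intro i j hj
    rw [htr.init_lam i j hj, htr.init_lam j i (mem_nbrs_comm.1 hj), map_zero, neg_zero]
  | succ t ih =>
    intro i j hj
    rw [htr.update_lam t i j hj, htr.update_lam t j i (mem_nbrs_comm.1 hj), ih i j hj,
      show tr.y (t + 1) j i - tr.z (t + 1) j i = _ from htr.isOpposite_residual t i j hj,
      map_add, map_smul]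
    module

/-- The Lyapunov function of the alternating direction method of multipliers. -/
noncomputable def lyapunov (N : Network V K D) (ρ : ℝ) (s : PrimalDual V K D) (tr : Trace V K D) (t : ℕ) : ℝ :=
  ∑ i, ∑ j ∈ N.nbrs i, (1 / (2 * ρ) * ‖s.lam i j - tr.lam t i j‖ ^ 2 +
    ρ / 2 * ‖s.z i j - tr.z t i j‖ ^ 2)

theorem IsRun.sum_localLagrangian_sub_le (hpdf : N.HasLogConcavePDFs) (hρ : 0 < ρ)
    {s : PrimalDual V K D} (hs : N.IsSolution s) (htr : N.IsRun ρ tr) (t : ℕ) :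
    ∑ i, N.localLagrangian ρ i (tr.y (t + 1) i) (tr.p (t + 1) i) (tr.z (t + 1) i) (s.lam i) -
        ∑ i, N.localLagrangian ρ i (s.y i) (s.p i) (s.z i) (s.lam i) ≤
      N.lyapunov ρ s tr t - N.lyapunov ρ s tr (t + 1) := by
  have h1 : ∀ i, N.localLagrangian ρ i (tr.y (t + 1) i) (tr.p (t + 1) i) (tr.z (t + 1) i)
        (s.lam i) - N.localLagrangian ρ i (s.y i) (s.p i) (s.z i) (s.lam i) ≤
      ∑ j ∈ N.nbrs i, (inner ℝ (tr.lam t i j + ρ • (tr.y (t + 1) i j - tr.z t i j))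
          (s.z i j - tr.y (t + 1) i j) + inner ℝ (s.lam i j) (tr.y (t + 1) i j - s.z i j) +
        ρ / 2 * ‖tr.y (t + 1) i j - tr.z (t + 1) i j‖ ^ 2) := by
    intro i
    have h := nodeCost_sub_le hpdf (htr.update_mem t i) (hs.admissible i) (htr.update_min t i)
    have e : ∑ j ∈ N.nbrs i, (inner ℝ (s.lam i j) (s.y i j) +
          ρ / 2 * ‖s.y i j - s.z i j‖ ^ 2) = ∑ j ∈ N.nbrs i, inner ℝ (s.lam i j) (s.z i j) :=
      Finset.sum_congr rfl fun j hj => by simp [hs.coupling i j hj]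
    have e' : ∑ j ∈ N.nbrs i, inner ℝ (tr.lam t i j + ρ • (tr.y (t + 1) i j - tr.z t i j))
          (s.y i j - tr.y (t + 1) i j) =
        ∑ j ∈ N.nbrs i, inner ℝ (tr.lam t i j + ρ • (tr.y (t + 1) i j - tr.z t i j))
          (s.z i j - tr.y (t + 1) i j) :=
      Finset.sum_congr rfl fun j hj => by rw [hs.coupling i j hj]
    rw [e'] at h
    rw [localLagrangian, localLagrangian, e]
    simp only [Finset.sum_add_distrib, inner_sub_right (s.lam i _), Finset.sum_sub_distrib] at h ⊢
    linarith
  have h2 := Finset.sum_le_sum fun i (_ : i ∈ Finset.univ) => h1 i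
  rw [Finset.sum_sub_distrib] at h2
  refine h2.trans ?_
  have h3 : ∑ i, ∑ j ∈ N.nbrs i, (inner ℝ (tr.lam t i j + ρ • (tr.y (t + 1) i j - tr.z t i j))
          (s.z i j - tr.y (t + 1) i j) + inner ℝ (s.lam i j) (tr.y (t + 1) i j - s.z i j) +
        ρ / 2 * ‖tr.y (t + 1) i j - tr.z (t + 1) i j‖ ^ 2) =
      ∑ i, ∑ j ∈ N.nbrs i, ((1 / (2 * ρ) * ‖s.lam i j - tr.lam t i j‖ ^ 2 +
          ρ / 2 * ‖s.z i j - tr.z t i j‖ ^ 2) -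
        (1 / (2 * ρ) * ‖s.lam i j - tr.lam (t + 1) i j‖ ^ 2 +
          ρ / 2 * ‖s.z i j - tr.z (t + 1) i j‖ ^ 2) -
        ρ / 2 * ‖tr.z (t + 1) i j - tr.z t i j‖ ^ 2 +
        inner ℝ (tr.lam (t + 1) i j) (s.z i j - tr.z (t + 1) i j) +
        inner ℝ (s.lam i j) (tr.z (t + 1) i j - s.z i j) -
        ρ * inner ℝ (tr.y (t + 1) i j - tr.z (t + 1) i j) (tr.z (t + 1) i j - tr.z t i j)) :=
    Finset.sum_congr rfl fun i _ => Finset.sum_congr rfl fun j hj => by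
      rw [admm_step_identity hρ.ne' (tr.y (t + 1) i j) (tr.z t i j) (tr.z (t + 1) i j) (s.z i j)
        (tr.lam t i j) (tr.lam (t + 1) i j) (s.lam i j) (htr.update_lam t i j hj)]
      ring
  -- The three cross terms of the identity vanish in the sum over the network: opposite against
  -- shared (`h4`, `h6`), and `λ*` against shared (`h5`). The square in `h7` is discarded.
  have h4 := (htr.isOpposite_lam (t + 1)).sum_inner_eq_zero
    (hs.shared.sub (htr.isShared_z (t + 1)))
  have h5 := hs.sum_inner_lam_eq_zero ((htr.isShared_z (t + 1)).sub hs.shared)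
  have h6 := (htr.isOpposite_residual t).sum_inner_eq_zero
    ((htr.isShared_z (t + 1)).sub (htr.isShared_z t))
  have h7 : 0 ≤ ∑ i, ∑ j ∈ N.nbrs i, ρ / 2 * ‖tr.z (t + 1) i j - tr.z t i j‖ ^ 2 :=
    Finset.sum_nonneg fun i _ => Finset.sum_nonneg fun j _ => by positivity
  have h8 (F₁ F₂ F₃ F₄ F₅ F₆ : V → V → ℝ) :
      ∑ i, ∑ j ∈ N.nbrs i, (F₁ i j - F₂ i j - F₃ i j + F₄ i j + F₅ i j - ρ * F₆ i j) =
        ∑ i, ∑ j ∈ N.nbrs i, F₁ i j - ∑ i, ∑ j ∈ N.nbrs i, F₂ i j -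
        ∑ i, ∑ j ∈ N.nbrs i, F₃ i j + ∑ i, ∑ j ∈ N.nbrs i, F₄ i j +
        ∑ i, ∑ j ∈ N.nbrs i, F₅ i j - ρ * ∑ i, ∑ j ∈ N.nbrs i, F₆ i j := by
    simp only [Finset.sum_add_distrib, Finset.sum_sub_distrib, ← Finset.mul_sum]
  rw [h3, h8, h4, h5, h6]
  unfold lyapunov
  linarith

theorem IsRun.lyapunov_zero (htr : N.IsRun ρ tr) (hρ : 0 < ρ) (s : PrimalDual V K D) :
    N.lyapunov ρ s tr 0 = 1 / (2 * ρ) * ∑ i, N.localInitialError ρ s i := by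
  rw [lyapunov, Finset.mul_sum]
  refine Finset.sum_congr rfl fun i _ => ?_
  rw [localInitialError, Finset.mul_sum, ← Finset.sum_add_distrib, Finset.mul_sum]
  refine Finset.sum_congr rfl fun j hj => ?_
  rw [htr.init_lam i j hj, htr.init_z i j hj, sub_zero, sub_zero]
  field_simp
  ring

theorem IsRun.sum_range_localLagrangian_le (hpdf : N.HasLogConcavePDFs) (hρ : 0 < ρ)
    {s : PrimalDual V K D} (hs : N.IsSolution s) (htr : N.IsRun ρ tr) (T : ℕ) :
    ∑ t ∈ Finset.range T, (∑ i, N.localLagrangian ρ i (tr.y (t + 1) i) (tr.p (t + 1) i)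
        (tr.z (t + 1) i) (s.lam i) -
        ∑ i, N.localLagrangian ρ i (s.y i) (s.p i) (s.z i) (s.lam i)) ≤
      1 / (2 * ρ) * ∑ i, N.localInitialError ρ s i := by
  have h1 := Finset.sum_le_sum fun t (_ : t ∈ Finset.range T) =>
    htr.sum_localLagrangian_sub_le hpdf hρ hs t
  rw [Finset.sum_range_sub', htr.lyapunov_zero hρ] at h1
  have h2 : 0 ≤ N.lyapunov ρ s tr T :=
    Finset.sum_nonneg fun i _ => Finset.sum_nonneg fun j _ => by positivity
  linarith

/-! ### Running averages and the ergodic rate -/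

theorem runningAvg_eq_sum {E : Type*} [AddCommGroup E] [Module ℝ E] (u : ℕ → E) (T : ℕ) :
    runningAvg u T = ∑ t ∈ Finset.range T, (1 / (T : ℝ)) • u (t + 1) := by
  rw [runningAvg, Finset.smul_sum]

/-- Jensen's inequality with weights `1/T`. The average starts at the first iterate: the zero
initial point need not be admissible. -/
theorem IsRun.runningAvg_admissible_and_le (hpdf : N.HasLogConcavePDFs) (hρ : 0 ≤ ρ)
    (htr : N.IsRun ρ tr) {T : ℕ} (hT : 1 ≤ T) (i : V) (lam : V → EdgeVec D) :
    N.IsAdmissible i (runningAvg (fun t => tr.y t i) T) (runningAvg (fun t => tr.p t i) T) ∧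
    N.localLagrangian ρ i (runningAvg (fun t => tr.y t i) T) (runningAvg (fun t => tr.p t i) T)
        (runningAvg (fun t => tr.z t i) T) lam ≤
      1 / (T : ℝ) * ∑ t ∈ Finset.range T, N.localLagrangian ρ i (tr.y (t + 1) i)
        (tr.p (t + 1) i) (tr.z (t + 1) i) lam := by
  have hconv := convexOn_localLagrangian hpdf hρ i lam
  have hw : ∑ t ∈ Finset.range T, 1 / (T : ℝ) = 1 := by
    have : (T : ℝ) ≠ 0 := by positivity
    simp [this]
  have hmem : ∀ t ∈ Finset.range T,
      (tr.y (t + 1) i, tr.p (t + 1) i, tr.z (t + 1) i) ∈ N.admissibleSet i :=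
    fun t _ => htr.update_mem t i
  have h1 := hconv.1.sum_mem (fun t _ => by positivity) hw hmem
  have h2 := hconv.map_sum_le (fun t _ => by positivity) hw hmem
  simp only [admissibleSet, Set.mem_ofPred_eq, Prod.fst_sum, Prod.snd_sum, Prod.smul_fst,
    Prod.smul_snd, smul_eq_mul, ← Finset.mul_sum] at h1 h2
  simp only [runningAvg_eq_sum]
  exact ⟨h1, h2⟩

theorem IsRun.isShared_runningAvg (htr : N.IsRun ρ tr) (T : ℕ) :
    N.IsShared fun i => runningAvg (fun t => tr.z t i) T := by
  have h := IsShared.sum (Finset.range T) fun t _ =>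
    (htr.isShared_z (t + 1)).smul (1 / (T : ℝ))
  intro i j hj
  simp only [runningAvg_eq_sum, Finset.sum_apply, Pi.smul_apply]
  exact h i j hj

theorem IsRun.avgLocalError_nonneg (hpdf : N.HasLogConcavePDFs) (hρ : 0 ≤ ρ)
    {s : PrimalDual V K D} (hs : N.IsSolution s) (htr : N.IsRun ρ tr) {T : ℕ} (hT : 1 ≤ T) :
    0 ≤ N.avgLocalError ρ s tr T := by
  rw [avgLocalError, Finset.sum_sub_distrib]
  exact mul_nonneg (by positivity) (sub_nonneg.2 (hs.sum_localLagrangian_le hρ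
    (fun i => (htr.runningAvg_admissible_and_le hpdf hρ hT i (s.lam i)).1)
    (htr.isShared_runningAvg T)))

/-- The ergodic `O(1/T)` rate: the average local error is at most the average of the local initial
errors divided by `2 ρ T`. -/
theorem IsRun.avgLocalError_le (hpdf : N.HasLogConcavePDFs) (hρ : 0 < ρ)
    {s : PrimalDual V K D} (hs : N.IsSolution s) (htr : N.IsRun ρ tr) {T : ℕ} (hT : 1 ≤ T) :
    N.avgLocalError ρ s tr T ≤
      1 / (Fintype.card V : ℝ) * (1 / T * (1 / (2 * ρ) * ∑ i, N.localInitialError ρ s i)) := by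
  rw [avgLocalError, Finset.sum_sub_distrib]
  refine mul_le_mul_of_nonneg_left ?_ (by positivity)
  have h1 := Finset.sum_le_sum fun i (_ : i ∈ Finset.univ) =>
    (htr.runningAvg_admissible_and_le hpdf hρ.le hT i (s.lam i)).2
  have h2 := mul_le_mul_of_nonneg_left (htr.sum_range_localLagrangian_le hpdf hρ hs T)
    (show 0 ≤ 1 / (T : ℝ) by positivity)
  have hT0 : (T : ℝ) ≠ 0 := by positivity
  rw [← Finset.mul_sum, Finset.sum_comm] at h1
  rw [Finset.sum_sub_distrib, Finset.sum_const, Finset.card_range, nsmul_eq_mul, mul_sub,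
    ← mul_assoc (1 / (T : ℝ)) T, one_div_mul_cancel hT0, one_mul] at h2
  linarith

theorem IsRun.reachesAccuracy (hpdf : N.HasLogConcavePDFs) [Nonempty V] {η : ℝ} (hρ : 0 < ρ)
    {s : PrimalDual V K D} (hs : N.IsSolution s) (htr : N.IsRun ρ tr) {T : ℕ} (hT : 1 ≤ T)
    (hE : ∀ i, N.localInitialError ρ s i ≤ 2 * ρ * η * T) : N.ReachesAccuracy ρ η s tr T := by
  refine ⟨fun i => (htr.runningAvg_admissible_and_le hpdf hρ.le hT i (s.lam i)).1.2,
    htr.avgLocalError_nonneg hpdf hρ.le hs hT, (htr.avgLocalError_le hpdf hρ hs hT).trans ?_⟩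
  have h := Finset.sum_le_sum fun i (_ : i ∈ Finset.univ) => hE i
  rw [Finset.sum_const, Finset.card_univ, nsmul_eq_mul] at h
  have hn : (0 : ℝ) < Fintype.card V := by exact_mod_cast Fintype.card_pos
  have hT0 : (0 : ℝ) < T := by exact_mod_cast hT
  calc 1 / (Fintype.card V : ℝ) * (1 / T * (1 / (2 * ρ) * ∑ i, N.localInitialError ρ s i))
      ≤ 1 / (Fintype.card V : ℝ) *
          (1 / T * (1 / (2 * ρ) * (Fintype.card V * (2 * ρ * η * T)))) := by gcongr
    _ = η := by field_simp

/-! ### From iterations to communication -/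

theorem commCost_eq (tr : Trace V K 2) (N : Network V K 2) (i : V) (T : ℕ) :
    N.commCost tr i T = 9 * (N.nbrs i).card * T := by
  simp [commCost, EdgeVec.numScalars]
  ring

/-- The summand 1 inside the ceiling is slack that this estimate does not need. -/
theorem localInitialError_le_of_iterationBound_le {η : ℝ} (hρ : 0 < ρ) (hη : 0 < η)
    {s : PrimalDual V K D} {T : ℕ} (hT : N.iterationBound ρ η s ≤ T) (j : V) :
    N.localInitialError ρ s j ≤ 2 * ρ * η * T := by
  have h : ⌈1 / (2 * ρ * η) * N.localInitialError ρ s j + 1⌉₊ ≤ T :=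
    (Finset.le_sup (f := fun i => ⌈1 / (2 * ρ * η) * N.localInitialError ρ s i + 1⌉₊)
      (Finset.mem_univ j)).trans hT
  have h' := Nat.ceil_le.1 h
  have hc : 0 < 2 * ρ * η := by positivity
  calc N.localInitialError ρ s j
      = 2 * ρ * η * (1 / (2 * ρ * η) * N.localInitialError ρ s j) := by field_simp
    _ ≤ 2 * ρ * η * T := mul_le_mul_of_nonneg_left (by linarith) hc.le

end Run

theorem localInitialError_eq_zero_of_subsingleton [Subsingleton V] (ρ : ℝ)
    (s : PrimalDual V K D) (j : V) : N.localInitialError ρ s j = 0 := by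
  have : N.nbrs j = ∅ := Finset.eq_empty_of_forall_notMem fun k hk =>
    (mem_nbrs.1 hk).ne (Subsingleton.elim j k)
  simp [localInitialError, this]

end Network

end SNL

theorem corollary1 {V K : Type*} [Fintype V] (N : SNL.Network V K 2)
    (hpdf : N.HasLogConcavePDFs) (hconn : N.graph.Connected)
    (ρ η : ℝ) (hρ : 0 < ρ) (hη : 0 < η)
    (s : SNL.Network.PrimalDual V K 2) (hs : N.IsSolution s)
    (tr : SNL.Network.Trace V K 2) (htr : N.IsRun ρ tr) (i : V) :
    -- the number of scalars that node `i` has sent after `T` iterations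
    (∀ T : ℕ, N.commCost tr i T = 9 * (N.nbrs i).card * T) ∧
    -- a communication cost of at least `9 |N_i| t_η` suffices for the accuracy `η`
    (∀ T : ℕ, 1 ≤ T → 9 * (N.nbrs i).card * N.iterationBound ρ η s ≤ N.commCost tr i T →
      N.ReachesAccuracy ρ η s tr T) ∧
    -- the bound depends on the network only through `|N_i|` and the worst local initial error
    (∀ R : ℝ, (∀ j, N.localInitialError ρ s j ≤ R) →
      9 * (N.nbrs i).card * N.iterationBound ρ η s ≤
        9 * (N.nbrs i).card * ⌈1 / (2 * ρ * η) * R + 1⌉₊) := by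
  have : Nonempty V := hconn.nonempty
  refine ⟨SNL.Network.commCost_eq tr N i, fun T hT hcost => ?_, fun R hR => ?_⟩
  · refine htr.reachesAccuracy hpdf hρ hs hT fun j => ?_
    -- A single node sends nothing, so the cost hypothesis is void, but without edges the initial
    -- error is zero and every `T ≥ 1` works. Otherwise connectedness gives `i` a neighbor, and `9
    -- |N_i|` can be cancelled.
    rcases subsingleton_or_nontrivial V with hV | hV
    · rw [SNL.Network.localInitialError_eq_zero_of_subsingleton]
      positivity
    · obtain ⟨k, hk⟩ := hconn.preconnected.exists_adj_of_nontrivial i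
      have hpos : 0 < 9 * (N.nbrs i).card :=
        mul_pos (by norm_num) (Finset.card_pos.2 ⟨k, SNL.Network.mem_nbrs.2 hk⟩)
      rw [SNL.Network.commCost_eq] at hcost
      exact SNL.Network.localInitialError_le_of_iterationBound_le hρ hη
        (Nat.le_of_mul_le_mul_left hcost hpos) j
  · refine Nat.mul_le_mul_left _ (Finset.sup_le fun j _ => Nat.ceil_mono ?_)
    have := mul_le_mul_of_nonneg_left (hR j) (show 0 ≤ 1 / (2 * ρ * η) by positivity)
    linarith
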